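/- Let $F$ be a field of characteristic zero and let $x$ and $q$ be formal variables. For a permutation $\pi=\pi_1\pi_2\cdots\pi_n$ of $\{1,\dots,n\}$, call $i\in\{1,\dots,n-1\}$ an alternating descent of $\pi$ if $i$ is odd and $\pi_i>\pi_{i+1}$, or $i$ is even and $\pi_i<\pi_{i+1}$; let $\operatorname{altmaj}(\pi)$ be the sum of the alternating descents of $\pi$. Let $\mathfrak S_n$ be the set of all permutations of $\{1,\dots,n\}$ (so $\mathfrak S_0$ consists of the empty permutation, with $\operatorname{altmaj}=0$), and let $\sec$ and $\tan$ denote the usual formal power series $1/\cos$ and $\sin/\cos$. Then in the ring $F[[q]][[x]]$ of formal power series $$\sum_{n=0}^{\infty}\frac{x^n}{n!}\,\frac{\sum_{\pi\in\mathfrak S_n}q^{\operatorname{altmaj}(\pi)}}{(1-q)(1-q^2)\cdots(1-q^n)}=\prod_{j=0}^{\infty}\bigl(\sec(xq^j)+\tan(xq^j)\bigr),$$ where the infinite product converges coefficientwise: for all $m,n\ge 0$ there is a finite set $S_0\subset\{0,1,2,\dots\}$ such that, for every finite set $S\supseteq S_0$, the coefficient of $q^m x^n$ in $\prod_{j\in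 S}(\sec(xq^j)+\tan(xq^j))$ equals that on the left side. -/

import Mathlib

open scoped PowerSeries.WithPiTopology

/-- For `π = π₁ π₂ ⋯ πₙ`, the position `i ∈ {1, …, n - 1}` is an alternating descent if `i` is odd
and `πᵢ > πᵢ₊₁`, or `i` is even and `πᵢ < πᵢ₊₁`. The entry `πᵢ` is the value of `π` at the
zero-based index `i - 1`. -/
def IsAltDescent {n : ℕ} (π : Equiv.Perm (Fin n)) (i : ℕ) : Prop :=
  ∃ (_ : 1 ≤ i) (h : i < n),
    (Odd i ∧ π ⟨i - 1, by omega⟩ > π ⟨i, h⟩) ∨ (Even i ∧ π ⟨i - 1, by omega⟩ < π ⟨i, h⟩)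

instance {n : ℕ} (π : Equiv.Perm (Fin n)) : DecidablePred (IsAltDescent π) := fun i => by
  unfold IsAltDescent
  infer_instance

/-- The alternating major index: the sum of the alternating descents. -/
def altMaj {n : ℕ} (π : Equiv.Perm (Fin n)) : ℕ :=
  ∑ i ∈ (Finset.range n).filter (IsAltDescent π), i

/-- The formal power series of the secant, `1 / cos`. -/
noncomputable def secSeries (K : Type*) [Field K] [CharZero K] : PowerSeries K :=
  (PowerSeries.cos K)⁻¹

/-- The formal power series of the tangent, `sin / cos`. -/
noncomputable def tanSeries (K : Type*) [Field K] [CharZero K] : PowerSeries K :=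
  PowerSeries.sin K * (PowerSeries.cos K)⁻¹

/-- For `f(x) ∈ K⟦x⟧` the series `f(x qʲ)` in `K⟦q⟧⟦x⟧`. -/
noncomputable def substMulPow {K : Type*} [Field K] (f : PowerSeries K) (j : ℕ) :
    PowerSeries (PowerSeries K) :=
  PowerSeries.rescale ((PowerSeries.X : PowerSeries K) ^ j)
    (PowerSeries.map (PowerSeries.C (R := K)) f)

/-- The series `∑ₙ (xⁿ / n!) · (∑_{π ∈ Sₙ} q ^ altmaj(π)) / ((1 - q) ⋯ (1 - qⁿ))` in `K⟦q⟧⟦x⟧`. -/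
noncomputable def altMajSeries (K : Type*) [Field K] [CharZero K] :
    PowerSeries (PowerSeries K) :=
  PowerSeries.mk fun n =>
    PowerSeries.C ((n.factorial : K)⁻¹) *
      ((∑ π : Equiv.Perm (Fin n), (PowerSeries.X : PowerSeries K) ^ altMaj π) *
        (∏ i ∈ Finset.Icc 1 n, (1 - (PowerSeries.X : PowerSeries K) ^ i))⁻¹)

open Finset

namespace AltMaj

/-! Position `i` is not an alternating descent exactly when "ascent at `i`" agrees with "`i` odd",
so `q ^ altMaj π` is the product over `i` of `q^i + (1 - q^i)[agreement at i]`. Expand it by the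
last position `m` where `q^i` is chosen: the prefix of length `m` keeps its full weight, the suffix
must alternate, and its letters can be chosen independently (`weightSum_succ`). After division by
`(1 - q) ⋯ (1 - qⁿ)` this recursion is `F(x) = F(qx) (sec x + tan x)` (`altMajSeries_eq_mul`).
Iterating gives `N` factors times `F(q^N x)`, which is `1` modulo `q^N`.

André's theorem, needed for `sec + tan`, comes from the same expansion with other weights
(`eulerNumber_succ`). -/

/-- The entry of `π` at the zero-based index `i`, and `0` beyond the end of the word. -/
def entry {n : ℕ} (π : Equiv.Perm (Fin n)) (i : ℕ) : ℕ :=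
  if h : i < n then π ⟨i, h⟩ else 0

/-- `π` has an ascent at the (one-based) position `i`. -/
def IsAscent {n : ℕ} (π : Equiv.Perm (Fin n)) (i : ℕ) : Prop :=
  entry π (i - 1) < entry π i

theorem isAscent_iff {n : ℕ} (π : Equiv.Perm (Fin n)) {i : ℕ} (hi : i < n) :
    IsAscent π i ↔ π ⟨i - 1, by omega⟩ < π ⟨i, hi⟩ := by
  have h : i - 1 < n := by omega
  simp [IsAscent, entry, hi, h]

theorem not_isAscent_iff {n : ℕ} (π : Equiv.Perm (Fin n)) {i : ℕ} (h1 : 1 ≤ i) (hi : i < n) :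
    ¬ IsAscent π i ↔ π ⟨i, hi⟩ < π ⟨i - 1, by omega⟩ := by
  rw [isAscent_iff π hi, not_lt]
  refine ⟨fun h => lt_of_le_of_ne h fun h' => ?_, le_of_lt⟩
  have := congrArg Fin.val (π.injective h')
  simp only at this
  omega

/-! ### Splitting a permutation into prefix and suffix -/

/-- The word whose first `m` letters are the elements of `s` in the relative order `σ`, followed by
the elements of the complement of `s` in the relative order `τ`. -/
def shuffleWord {m k : ℕ} (s : {s : Finset (Fin (m + k)) // s.card = m})
    (σ : Equiv.Perm (Fin m)) (τ : Equiv.Perm (Fin k)) : Fin (m + k) → Fin (m + k) :=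
  Fin.append (fun i => s.1.orderEmbOfFin s.2 (σ i))
    (fun j => s.1ᶜ.orderEmbOfFin (by rw [card_compl, s.2, Fintype.card_fin]; omega) (τ j))

theorem shuffleWord_injective {m k : ℕ} (s : {s : Finset (Fin (m + k)) // s.card = m})
    (σ : Equiv.Perm (Fin m)) (τ : Equiv.Perm (Fin k)) : Function.Injective (shuffleWord s σ τ) := by
  rw [shuffleWord, Fin.append_injective_iff]
  refine ⟨fun a b h => by simpa using h, fun a b h => by simpa using h, fun i j h => ?_⟩
  have h1 := s.1.orderEmbOfFin_mem s.2 (σ i)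
  rw [h] at h1
  exact mem_compl.1 (s.1ᶜ.orderEmbOfFin_mem _ (τ j)) h1

/-- `shuffleWord` as a permutation. -/
noncomputable def shuffle {m k : ℕ}
    (t : {s : Finset (Fin (m + k)) // s.card = m} × Equiv.Perm (Fin m) × Equiv.Perm (Fin k)) :
    Equiv.Perm (Fin (m + k)) :=
  Equiv.ofBijective (shuffleWord t.1 t.2.1 t.2.2)
    (Finite.injective_iff_bijective.1 (shuffleWord_injective t.1 t.2.1 t.2.2))

theorem shuffle_castAdd {m k : ℕ} (s : {s : Finset (Fin (m + k)) // s.card = m})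
    (σ : Equiv.Perm (Fin m)) (τ : Equiv.Perm (Fin k)) (i : Fin m) :
    shuffle (s, σ, τ) (Fin.castAdd k i) = s.1.orderEmbOfFin s.2 (σ i) := by
  simp [shuffle, shuffleWord]

theorem shuffle_natAdd {m k : ℕ} (s : {s : Finset (Fin (m + k)) // s.card = m})
    (σ : Equiv.Perm (Fin m)) (τ : Equiv.Perm (Fin k)) (j : Fin k) :
    shuffle (s, σ, τ) (Fin.natAdd m j) =
      s.1ᶜ.orderEmbOfFin (by rw [card_compl, s.2, Fintype.card_fin]; omega) (τ j) := by
  simp [shuffle, shuffleWord]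

theorem shuffle_injective {m k : ℕ} : Function.Injective (shuffle (m := m) (k := k)) := by
  rintro ⟨s, σ, τ⟩ ⟨s', σ', τ'⟩ h
  have hs : s = s' := by
    -- The set `s` is recovered as the set of the first `m` letters.
    have key : ∀ (s : {s : Finset (Fin (m + k)) // s.card = m}) (σ : Equiv.Perm (Fin m))
        (τ : Equiv.Perm (Fin k)),
        (s.1 : Set (Fin (m + k))) = Set.range fun i => shuffle (s, σ, τ) (Fin.castAdd k i) := by
      intro s σ τ
      simp only [shuffle_castAdd]
      rw [← s.1.range_orderEmbOfFin s.2]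
      exact (σ.surjective.range_comp _).symm
    refine Subtype.ext (Finset.coe_injective ?_)
    rw [key s σ τ, key s' σ' τ', h]
  subst hs
  have hσ : σ = σ' := Equiv.ext fun i => by
    have := congrArg (fun e => e (Fin.castAdd k i)) h
    simpa only [shuffle_castAdd, EmbeddingLike.apply_eq_iff_eq] using this
  have hτ : τ = τ' := Equiv.ext fun i => by
    have := congrArg (fun e => e (Fin.natAdd m i)) h
    simpa only [shuffle_natAdd, EmbeddingLike.apply_eq_iff_eq] using this
  rw [hσ, hτ]

theorem shuffle_bijective {m k : ℕ} : Function.Bijective (shuffle (m := m) (k := k)) := by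
  rw [Fintype.bijective_iff_injective_and_card]
  refine ⟨shuffle_injective, ?_⟩
  simp only [Fintype.card_prod, Fintype.card_finset_len, Fintype.card_perm, Fintype.card_fin]
  rw [← Nat.add_choose_mul_factorial_mul_factorial m k, mul_assoc, Nat.choose_symm_add]

theorem isAscent_shuffle_left {m k : ℕ} (s : {s : Finset (Fin (m + k)) // s.card = m})
    (σ : Equiv.Perm (Fin m)) (τ : Equiv.Perm (Fin k)) {i : ℕ} (hi : i < m) :
    IsAscent (shuffle (s, σ, τ)) i ↔ IsAscent σ i := by
  rw [isAscent_iff _ hi, isAscent_iff _ (show i < m + k by omega)]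
  have h1 := shuffle_castAdd s σ τ ⟨i, hi⟩
  have h2 := shuffle_castAdd s σ τ ⟨i - 1, by omega⟩
  simp only [Fin.castAdd_mk] at h1 h2
  rw [h1, h2, OrderEmbedding.lt_iff_lt]

theorem isAscent_shuffle_right {m k : ℕ} (s : {s : Finset (Fin (m + k)) // s.card = m})
    (σ : Equiv.Perm (Fin m)) (τ : Equiv.Perm (Fin k)) {j : ℕ} (h1 : 1 ≤ j) (hj : j < k) :
    IsAscent (shuffle (s, σ, τ)) (m + j) ↔ IsAscent τ j := by
  rw [isAscent_iff _ hj, isAscent_iff _ (show m + j < m + k by omega)]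
  have e1 := shuffle_natAdd s σ τ ⟨j, hj⟩
  have e2 := shuffle_natAdd s σ τ ⟨j - 1, by omega⟩
  simp only [Fin.natAdd_mk, ← Nat.add_sub_assoc h1] at e1 e2
  rw [e1, e2, OrderEmbedding.lt_iff_lt]

/-- A weight that depends only on the ascents inside the first `m` letters and inside the last `k`
letters factors through the relative orders of the two parts. -/
theorem sum_perm_add {R : Type*} [CommRing R] (m k : ℕ) (f g : ℕ → Prop → R) :
    ∑ π : Equiv.Perm (Fin (m + k)), (∏ i ∈ Ico 1 m, f i (IsAscent π i)) *
        ∏ j ∈ Ico 1 k, g j (IsAscent π (m + j)) =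
      (m + k).choose m * (∑ σ : Equiv.Perm (Fin m), ∏ i ∈ Ico 1 m, f i (IsAscent σ i)) *
        ∑ τ : Equiv.Perm (Fin k), ∏ j ∈ Ico 1 k, g j (IsAscent τ j) := by
  rw [← Fintype.sum_bijective shuffle shuffle_bijective
    (fun t => (∏ i ∈ Ico 1 m, f i (IsAscent t.2.1 i)) * ∏ j ∈ Ico 1 k, g j (IsAscent t.2.2 j))]
  · simp only [Fintype.sum_prod_type, sum_const, card_univ, Fintype.card_finset_len,
      Fintype.card_fin, nsmul_eq_mul, ← mul_sum, ← sum_mul, mul_assoc]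
  · rintro ⟨s, σ, τ⟩
    congr 1
    · refine prod_congr rfl fun i hi => ?_
      rw [isAscent_shuffle_left s σ τ (mem_Ico.1 hi).2]
    · refine prod_congr rfl fun j hj => ?_
      rw [isAscent_shuffle_right s σ τ (mem_Ico.1 hj).1 (mem_Ico.1 hj).2]

/-! ### Weighted sums over ascent patterns -/

open Classical in
/-- The number of permutations of `n` letters whose ascents are the positions in `d`. -/
noncomputable def countAscents (R : Type*) [CommRing R] (d : ℕ → Prop) (n : ℕ) : R :=
  ∑ π : Equiv.Perm (Fin n), ∏ i ∈ Ico 1 n, if (IsAscent π i ↔ d i) then 1 else 0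

open Classical in
/-- The sum over all permutations of the product of the weights `x i + y i` at the positions `i`
which follow the pattern `d`, and `x i` at the others. -/
noncomputable def weightSum {R : Type*} [CommRing R] (d : ℕ → Prop) (x y : ℕ → R) (n : ℕ) : R :=
  ∑ π : Equiv.Perm (Fin n), ∏ i ∈ Ico 1 n, (x i + y i * if (IsAscent π i ↔ d i) then 1 else 0)

/-- Group the terms by the last index `p.1` where `x` is chosen; `p.1 = 0` stands for "never",
whence `x 0 = 1`. -/
theorem prod_Ico_add_eq_sum {R : Type*} [CommRing R] (x z : ℕ → R) (h0 : x 0 = 1) (n : ℕ) :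
    ∏ i ∈ Ico 1 (n + 1), (x i + z i) =
      ∑ p ∈ antidiagonal n, x p.1 * (∏ i ∈ Ico 1 p.1, (x i + z i)) *
        ∏ j ∈ Ico 1 (p.2 + 1), z (p.1 + j) := by
  induction n with
  | zero => simp [h0]
  | succ n ih =>
    rw [Nat.sum_antidiagonal_succ', prod_Ico_succ_top (by omega), mul_add]
    simp only [zero_add, Ico_self, prod_empty, mul_one]
    rw [mul_comm (x (n + 1))]
    congr 1
    rw [ih, sum_mul]
    refine sum_congr rfl fun p hp => ?_
    rw [prod_Ico_succ_top (show 1 ≤ p.2 + 1 by omega), ← add_assoc p.1, mem_antidiagonal.1 hp]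
    ring

/-- The expansion of `weightSum` according to the last position at which `x` is chosen. -/
theorem weightSum_succ {R : Type*} [CommRing R] (d : ℕ → Prop) (x y : ℕ → R) (h0 : x 0 = 1)
    (n : ℕ) :
    weightSum d x y (n + 1) = ∑ p ∈ antidiagonal n,
      x p.1 * (∏ j ∈ Ico 1 (p.2 + 1), y (p.1 + j)) * (n + 1).choose p.1 * weightSum d x y p.1 *
        countAscents R (fun j => d (p.1 + j)) (p.2 + 1) := by
  classical
  unfold weightSum
  simp_rw [prod_Ico_add_eq_sum x _ h0 n]
  rw [Finset.sum_comm]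
  refine Finset.sum_congr rfl fun p hp => ?_
  obtain ⟨m, k⟩ := p
  obtain rfl : m + k = n := mem_antidiagonal.1 hp
  have := sum_perm_add m (k + 1) (fun i P => x i + y i * if (P ↔ d i) then 1 else 0)
    (fun j P => if (P ↔ d (m + j)) then (1 : R) else 0)
  simp only [countAscents, prod_mul_distrib]
  rw [show m + k + 1 = m + (k + 1) from rfl]
  simp only [mul_assoc] at this ⊢
  rw [← this, mul_sum, mul_sum]
  refine sum_congr rfl fun π _ => ?_
  ring

theorem countAscents_congr {R : Type*} [CommRing R] {d d' : ℕ → Prop} {n : ℕ}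
    (h : ∀ i ∈ Ico 1 n, (d i ↔ d' i)) : countAscents R d n = countAscents R d' n := by
  unfold countAscents
  refine sum_congr rfl fun π _ => prod_congr rfl fun i hi => ?_
  rw [propext (h i hi)]

theorem isAscent_mul_revPerm {n : ℕ} (π : Equiv.Perm (Fin n)) {i : ℕ} (h1 : 1 ≤ i) (hi : i < n) :
    IsAscent (Fin.revPerm * π) i ↔ ¬ IsAscent π i := by
  rw [not_isAscent_iff π h1 hi, isAscent_iff _ hi]
  simp

/-- Reversing the order of the values exchanges ascents and descents. -/
theorem countAscents_not (R : Type*) [CommRing R] (d : ℕ → Prop) (n : ℕ) :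
    countAscents R (fun i => ¬ d i) n = countAscents R d n := by
  unfold countAscents
  rw [← Equiv.sum_comp (Equiv.mulLeft (Fin.revPerm : Equiv.Perm (Fin n)))]
  refine sum_congr rfl fun π _ => prod_congr rfl fun i hi => ?_
  rw [Equiv.coe_mulLeft, isAscent_mul_revPerm π (mem_Ico.1 hi).1 (mem_Ico.1 hi).2]
  congr 1
  exact propext not_iff_not

/-! ### Euler numbers and André's theorem -/

/-- The Euler number: the number of alternating permutations of `n` letters. -/
noncomputable def eulerNumber (R : Type*) [CommRing R] (n : ℕ) : R := countAscents R Odd n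

/-- An odd shift complements the alternating pattern, which does not change the count. -/
theorem countAscents_odd_shift (R : Type*) [CommRing R] (m n : ℕ) :
    countAscents R (fun j => Odd (m + j)) n = eulerNumber R n := by
  rcases Nat.even_or_odd m with hm | hm
  · exact countAscents_congr fun i _ => by grind
  · rw [eulerNumber, ← countAscents_not]
    exact countAscents_congr fun i _ => by grind

theorem countAscents_zero (R : Type*) [CommRing R] (d : ℕ → Prop) : countAscents R d 0 = 1 := by
  simp [countAscents]

theorem forall_isAscent_iff {n : ℕ} (π : Equiv.Perm (Fin n)) :
    (∀ i ∈ Ico 1 n, IsAscent π i) ↔ π = 1 := by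
  constructor
  · intro h
    cases n with
    | zero => exact Subsingleton.elim _ _
    | succ n =>
      have hm : StrictMono π := Fin.strictMono_iff_lt_succ.2 fun i => by
        have := (isAscent_iff π (show (i : ℕ) + 1 < n + 1 by omega)).1 (h _ (by simp))
        exact this
      ext i
      exact congrArg Fin.val hm.apply_eq
  · rintro rfl i hi
    rw [isAscent_iff _ (mem_Ico.1 hi).2]
    simp only [mem_Ico] at hi
    simp only [Equiv.Perm.coe_one, id_eq, Fin.mk_lt_mk]
    omega

theorem countAscents_true (R : Type*) [CommRing R] (n : ℕ) :
    countAscents R (fun _ => True) n = 1 := by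
  classical
  unfold countAscents
  rw [sum_eq_single 1]
  · exact prod_eq_one fun i hi => by simp [(forall_isAscent_iff (1 : Equiv.Perm (Fin n))).2 rfl i hi]
  · intro π _ hπ
    rw [Ne, ← forall_isAscent_iff] at hπ
    push Not at hπ
    obtain ⟨i, hi, h⟩ := hπ
    exact prod_eq_zero hi (by simp [h])
  · simp

theorem prod_neg_one_pow (R : Type*) [CommRing R] {m : ℕ} (hm : Even m) (k : ℕ) :
    ∏ j ∈ Ico 1 (k + 1), (-1 : R) ^ (m + j + 1) = (-1) ^ (k / 2) := by
  induction k with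
  | zero => simp
  | succ k ih =>
    rw [prod_Ico_succ_top (by omega), ih, ← pow_add]
    obtain ⟨a, rfl⟩ := hm
    rcases Nat.even_or_odd' k with ⟨b, rfl | rfl⟩
    · rw [show 2 * b / 2 + (a + a + (2 * b + 1) + 1) = 2 * (a + b + 1) + b by omega,
        show (2 * b + 1) / 2 = b by omega, pow_add, pow_mul]
      simp
    · rw [show (2 * b + 1) / 2 + (a + a + (2 * b + 1 + 1) + 1) = 2 * (a + b + 1) + (b + 1) by omega,
        show (2 * b + 1 + 1) / 2 = b + 1 by omega, pow_add, pow_mul]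
      simp

theorem eulerNumber_succ (R : Type*) [CommRing R] (n : ℕ) :
    eulerNumber R (n + 1) = ∑ p ∈ antidiagonal n,
      if Even p.1 then (-1) ^ (p.2 / 2) * (n + 1).choose p.1 * eulerNumber R p.1 else 0 := by
  -- `[ascent iff i odd]` is `[ascent]` for odd `i` and `1 - [ascent]` for even `i`. The suffix is
  -- then increasing, so it has a single relative order.
  have key : ∀ n, weightSum (fun _ => True) (fun i => if Even i then (1 : R) else 0)
      (fun i => (-1) ^ (i + 1)) n = eulerNumber R n := by
    intro n
    unfold weightSum eulerNumber countAscents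
    refine sum_congr rfl fun π _ => prod_congr rfl fun i _ => ?_
    rcases Nat.even_or_odd i with hi | hi
    · have h' : ¬ Odd i := by simpa using hi
      by_cases h : IsAscent π i <;> simp [hi, h', h, pow_succ]
    · have h' : ¬ Even i := by simpa using hi
      by_cases h : IsAscent π i <;> simp [hi, h', h, pow_succ]
  rw [← key, weightSum_succ _ _ _ (by simp)]
  refine sum_congr rfl fun p _ => ?_
  rw [key, countAscents_true]
  split_ifs with h
  · rw [prod_neg_one_pow R h, one_mul, mul_one]
  · simp

theorem choose_div_factorial (K : Type*) [Field K] [CharZero K] {m k n : ℕ} (h : m + k = n) :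
    (n.choose m : K) / n.factorial = 1 / (m.factorial * k.factorial) := by
  subst h
  have h1 : ((m + k).factorial : K) ≠ 0 := by exact_mod_cast (m + k).factorial_ne_zero
  have h2 : (m.factorial : K) ≠ 0 := by exact_mod_cast m.factorial_ne_zero
  have h3 : (k.factorial : K) ≠ 0 := by exact_mod_cast k.factorial_ne_zero
  rw [div_eq_div_iff h1 (mul_ne_zero h2 h3), one_mul, ← mul_assoc]
  have := Nat.add_choose_mul_factorial_mul_factorial m k
  rw [← Nat.choose_symm_add] at this
  exact_mod_cast this

theorem eulerNumber_succ_div (K : Type*) [Field K] [CharZero K] (n : ℕ) :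
    eulerNumber K (n + 1) / (n + 1).factorial = ∑ p ∈ antidiagonal n,
      if Even p.1 then eulerNumber K p.1 / p.1.factorial *
        ((-1) ^ (p.2 / 2) / (p.2 + 1).factorial) else 0 := by
  rw [eulerNumber_succ, sum_div]
  refine sum_congr rfl fun p hp => ?_
  split_ifs with h
  · have := choose_div_factorial K (m := p.1) (k := p.2 + 1) (n := n + 1)
      (by rw [← mem_antidiagonal.1 hp, add_assoc])
    rw [mul_right_comm, mul_div_assoc, this]
    ring
  · exact zero_div _

theorem eulerNumber_zero (R : Type*) [CommRing R] : eulerNumber R 0 = 1 := countAscents_zero R _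

/-- The even part of the exponential generating function of the Euler numbers. -/
noncomputable def evenEulerSeries (K : Type*) [Field K] : PowerSeries K :=
  PowerSeries.mk fun n => if Even n then eulerNumber K n / n.factorial else 0

theorem evenEulerSeries_mul_cos (K : Type*) [Field K] [CharZero K] :
    evenEulerSeries K * PowerSeries.cos K = 1 := by
  ext n
  rw [PowerSeries.coeff_mul]
  cases n with
  | zero => simp [evenEulerSeries, PowerSeries.cos, eulerNumber_zero]
  | succ n =>
    rw [Nat.sum_antidiagonal_succ', PowerSeries.coeff_one, if_neg (by omega)]
    simp only [evenEulerSeries, PowerSeries.cos, PowerSeries.coeff_mk]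
    by_cases hn : Even (n + 1)
    · rw [if_pos hn, eulerNumber_succ_div]
      simp only [Even.zero, if_true, Nat.zero_div, pow_zero, Nat.factorial_zero, Nat.cast_one,
        div_one, map_one, mul_one]
      rw [← sum_add_distrib]
      refine sum_eq_zero fun p hp => ?_
      have hp := mem_antidiagonal.1 hp
      by_cases h : Even p.1
      · have h2 : Even (p.2 + 1) := by grind
        -- This extra sign makes the cosine terms cancel the recursion for the Euler number.
        have h3 : (p.2 + 1) / 2 = p.2 / 2 + 1 := by grind
        simp only [h, h2, h3, if_true, map_div₀, map_pow, map_neg, map_one, map_natCast, pow_succ,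
          map_mul]
        ring
      · simp [h]
    · rw [if_neg hn, zero_mul, zero_add]
      refine sum_eq_zero fun p hp => ?_
      have hp := mem_antidiagonal.1 hp
      by_cases h : Even p.1
      · have h2 : ¬ Even (p.2 + 1) := by grind
        simp [h2]
      · simp [h]

theorem coeff_sin_mul_evenEulerSeries (K : Type*) [Field K] [CharZero K] (n : ℕ) :
    PowerSeries.coeff n (PowerSeries.sin K * evenEulerSeries K) =
      if Even n then 0 else eulerNumber K n / n.factorial := by
  rw [mul_comm, PowerSeries.coeff_mul]
  cases n with
  | zero => simp [evenEulerSeries, PowerSeries.sin]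
  | succ n =>
    rw [Nat.sum_antidiagonal_succ']
    simp only [evenEulerSeries, PowerSeries.sin, PowerSeries.coeff_mk, Even.zero, if_true, mul_zero,
      zero_add]
    by_cases hn : Even (n + 1)
    · rw [if_pos hn]
      refine sum_eq_zero fun p hp => ?_
      have hp := mem_antidiagonal.1 hp
      by_cases h : Even p.1
      · have h2 : Even (p.2 + 1) := by grind
        simp [h2]
      · simp [h]
    · rw [if_neg hn, eulerNumber_succ_div]
      refine sum_congr rfl fun p hp => ?_
      have hp := mem_antidiagonal.1 hp
      by_cases h : Even p.1
      · have h2 : ¬ Even (p.2 + 1) := by grind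
        have h3 : (p.2 + 1) / 2 = p.2 / 2 := by grind
        simp only [h, h2, h3, if_true, if_false, map_div₀, map_pow, map_neg, map_one, map_natCast]
      · simp [h]

/-- André's theorem: `sec + tan` is the exponential generating function of the Euler numbers. -/
theorem coeff_secSeries_add_tanSeries (K : Type*) [Field K] [CharZero K] (n : ℕ) :
    PowerSeries.coeff n (secSeries K + tanSeries K) = eulerNumber K n / n.factorial := by
  have h0 : PowerSeries.constantCoeff (PowerSeries.cos K) ≠ 0 := by
    rw [← PowerSeries.coeff_zero_eq_constantCoeff_apply]
    simp [PowerSeries.cos]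
  have hs : (PowerSeries.cos K)⁻¹ = evenEulerSeries K :=
    ((PowerSeries.eq_inv_iff_mul_eq_one h0).2 (evenEulerSeries_mul_cos K)).symm
  rw [secSeries, tanSeries, hs, map_add, coeff_sin_mul_evenEulerSeries, evenEulerSeries,
    PowerSeries.coeff_mk]
  split_ifs <;> simp

/-! ### Recursion for the alternating major index -/

theorem isAltDescent_iff {n : ℕ} (π : Equiv.Perm (Fin n)) {i : ℕ} (h1 : 1 ≤ i) (hi : i < n) :
    IsAltDescent π i ↔ ¬ (IsAscent π i ↔ Odd i) := by
  have ha := isAscent_iff π hi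
  have hd := not_isAscent_iff π h1 hi
  simp only [IsAltDescent, h1, hi, exists_true_left, gt_iff_lt, ← ha, ← hd,
    ← Nat.not_odd_iff_even]
  tauto

theorem X_pow_altMaj (K : Type*) [Field K] (n : ℕ) :
    ∑ π : Equiv.Perm (Fin n), (PowerSeries.X : PowerSeries K) ^ altMaj π =
      weightSum Odd (fun i => PowerSeries.X ^ i) (fun i => 1 - PowerSeries.X ^ i) n := by
  classical
  unfold weightSum
  refine sum_congr rfl fun π _ => ?_
  rw [altMaj, ← prod_pow_eq_pow_sum, prod_filter]
  -- The index `0` in `altMaj` is never an alternating descent.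
  have hsub : Ico 1 n ⊆ range n := fun i hi => by simp at hi ⊢; omega
  rw [← prod_subset hsub]
  · refine prod_congr rfl fun i hi => ?_
    simp only [isAltDescent_iff π (mem_Ico.1 hi).1 (mem_Ico.1 hi).2]
    by_cases h : (IsAscent π i ↔ Odd i) <;> simp [h]
  · intro i hi hi'
    have : i = 0 := by simp at hi hi'; omega
    rw [if_neg]
    rintro ⟨h, -⟩
    omega

theorem map_countAscents {R S : Type*} [CommRing R] [CommRing S] (f : R →+* S) (d : ℕ → Prop)
    (n : ℕ) : f (countAscents R d n) = countAscents S d n := by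
  classical
  simp only [countAscents, map_sum, map_prod, apply_ite f, map_one, map_zero]

/-- The `q`-Pochhammer product `(1 - q) ⋯ (1 - qⁿ)`. -/
noncomputable def qFactorial (K : Type*) [Field K] (n : ℕ) : PowerSeries K :=
  ∏ i ∈ Icc 1 n, (1 - PowerSeries.X ^ i)

theorem constantCoeff_qFactorial (K : Type*) [Field K] (n : ℕ) :
    PowerSeries.constantCoeff (qFactorial K n) = 1 := by
  rw [qFactorial, map_prod]
  refine prod_eq_one fun i hi => ?_
  have : i ≠ 0 := by simp at hi; omega
  simp [this]

theorem qFactorial_mul_inv (K : Type*) [Field K] (n : ℕ) :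
    qFactorial K n * (qFactorial K n)⁻¹ = 1 :=
  PowerSeries.mul_inv_cancel _ (by simp [constantCoeff_qFactorial])

theorem qFactorial_add (K : Type*) [Field K] (m k : ℕ) :
    qFactorial K (m + k) =
      qFactorial K m * ∏ j ∈ Ico 1 (k + 1), (1 - PowerSeries.X ^ (m + j)) := by
  induction k with
  | zero => simp
  | succ k ih =>
    rw [prod_Ico_succ_top (by omega), ← mul_assoc, ← ih, qFactorial, ← add_assoc,
      prod_Icc_succ_top (by omega), ← qFactorial, add_assoc]

/-- The quotient of the generating polynomial of `altMaj` on `n` letters by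
`(1 - q) ⋯ (1 - qⁿ)`. -/
noncomputable def altMajQuotient (K : Type*) [Field K] (n : ℕ) : PowerSeries K :=
  (∑ π : Equiv.Perm (Fin n), (PowerSeries.X : PowerSeries K) ^ altMaj π) * (qFactorial K n)⁻¹

theorem altMajQuotient_succ (K : Type*) [Field K] (n : ℕ) :
    altMajQuotient K (n + 1) * (1 - PowerSeries.X ^ (n + 1)) = ∑ p ∈ antidiagonal n,
      PowerSeries.X ^ p.1 * ((n + 1).choose p.1 : PowerSeries K) * altMajQuotient K p.1 *
        PowerSeries.C (eulerNumber K (p.2 + 1)) := by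
  have hq : qFactorial K (n + 1) = qFactorial K n * (1 - PowerSeries.X ^ (n + 1)) := by
    simpa using qFactorial_add K n 1
  have h1 := qFactorial_mul_inv K n
  have h2 := qFactorial_mul_inv K (n + 1)
  rw [hq] at h2
  have h3 : (1 - PowerSeries.X ^ (n + 1)) * (qFactorial K n * (1 - PowerSeries.X ^ (n + 1)))⁻¹ =
      (qFactorial K n)⁻¹ := by
    linear_combination (qFactorial K n)⁻¹ * h2 - (1 - PowerSeries.X ^ (n + 1)) *
      (qFactorial K n * (1 - PowerSeries.X ^ (n + 1)))⁻¹ * h1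
  rw [altMajQuotient, mul_assoc, mul_comm _ (1 - _), hq, h3, X_pow_altMaj,
    weightSum_succ _ _ _ (by simp), sum_mul]
  refine sum_congr rfl fun p hp => ?_
  obtain ⟨m, k⟩ := p
  obtain rfl : m + k = n := mem_antidiagonal.1 hp
  rw [countAscents_odd_shift, altMajQuotient, X_pow_altMaj]
  simp only [eulerNumber, map_countAscents]
  have h4 := qFactorial_add K m k
  have h5 := qFactorial_mul_inv K m
  have h6 : (∏ j ∈ Ico 1 (k + 1), (1 - PowerSeries.X ^ (m + j))) * (qFactorial K (m + k))⁻¹ =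
      (qFactorial K m)⁻¹ := by
    rw [h4] at h1 ⊢
    linear_combination (qFactorial K m)⁻¹ * h1 - (∏ j ∈ Ico 1 (k + 1),
      (1 - PowerSeries.X ^ (m + j))) * (qFactorial K m * ∏ j ∈ Ico 1 (k + 1),
      (1 - PowerSeries.X ^ (m + j)))⁻¹ * h5
  rw [← h6]
  ring

theorem altMajQuotient_zero (K : Type*) [Field K] : altMajQuotient K 0 = 1 := by
  simp [altMajQuotient, qFactorial, altMaj]

/-! ### The functional equation -/

theorem coeff_altMajSeries (K : Type*) [Field K] [CharZero K] (n : ℕ) :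
    PowerSeries.coeff n (altMajSeries K) =
      PowerSeries.C ((n.factorial : K)⁻¹) * altMajQuotient K n := by
  rw [altMajSeries, PowerSeries.coeff_mk, altMajQuotient, qFactorial]

theorem altMajSeries_eq_mul (K : Type*) [Field K] [CharZero K] :
    altMajSeries K = PowerSeries.rescale PowerSeries.X (altMajSeries K) *
      PowerSeries.map PowerSeries.C (secSeries K + tanSeries K) := by
  refine PowerSeries.ext fun n => ?_
  rw [PowerSeries.coeff_mul]
  simp only [PowerSeries.coeff_rescale, PowerSeries.coeff_map, coeff_altMajSeries,
    coeff_secSeries_add_tanSeries]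
  cases n with
  | zero => simp [altMajQuotient_zero, eulerNumber_zero]
  | succ n =>
    rw [Nat.sum_antidiagonal_succ']
    simp only [eulerNumber_zero, Nat.factorial_zero, Nat.cast_one, div_one, map_one, mul_one]
    -- Moving the term of `p = (n + 1, 0)` to the left produces the factor `1 - q^(n+1)`.
    rw [← sub_eq_iff_eq_add']
    have := congrArg (PowerSeries.C (((n + 1).factorial : K)⁻¹) * ·) (altMajQuotient_succ K n)
    simp only [mul_sum] at this
    rw [show PowerSeries.C (((n + 1).factorial : K)⁻¹) * altMajQuotient K (n + 1) -
      PowerSeries.X ^ (n + 1) *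
        (PowerSeries.C (((n + 1).factorial : K)⁻¹) * altMajQuotient K (n + 1)) =
      PowerSeries.C (((n + 1).factorial : K)⁻¹) *
        (altMajQuotient K (n + 1) * (1 - PowerSeries.X ^ (n + 1))) by ring, this]
    refine sum_congr rfl fun p hp => ?_
    have hc := choose_div_factorial K (m := p.1) (k := p.2 + 1) (n := n + 1)
      (by rw [← mem_antidiagonal.1 hp, add_assoc])
    have hc' : PowerSeries.C (((n + 1).factorial : K)⁻¹) * ((n + 1).choose p.1 : PowerSeries K) =
        PowerSeries.C ((p.1.factorial : K)⁻¹) * PowerSeries.C (((p.2 + 1).factorial : K)⁻¹) := by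
      rw [← map_natCast (PowerSeries.C (R := K)), ← map_mul, ← map_mul, mul_comm, ← div_eq_mul_inv,
        hc, one_div, mul_inv]
    rw [div_eq_mul_inv, map_mul]
    linear_combination PowerSeries.X ^ p.1 * altMajQuotient K p.1 *
      PowerSeries.C (eulerNumber K (p.2 + 1)) * hc'

/-! ### The infinite product -/

/-- The `j`-th factor `sec (x qʲ) + tan (x qʲ)` of the product. -/
noncomputable def secTanFactor (K : Type*) [Field K] [CharZero K] (j : ℕ) :
    PowerSeries (PowerSeries K) :=
  substMulPow (secSeries K + tanSeries K) j

theorem altMajSeries_eq_prod_mul (K : Type*) [Field K] [CharZero K] (N : ℕ) :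
    altMajSeries K = (∏ j ∈ range N, secTanFactor K j) *
      PowerSeries.rescale (PowerSeries.X ^ N) (altMajSeries K) := by
  induction N with
  | zero => simp
  | succ N ih =>
    have h := congrArg (PowerSeries.rescale (PowerSeries.X ^ N)) (altMajSeries_eq_mul K)
    rw [map_mul, PowerSeries.rescale_rescale, ← pow_succ'] at h
    rw [prod_range_succ, secTanFactor, substMulPow, mul_assoc,
      mul_comm (PowerSeries.rescale (PowerSeries.X ^ N) _), ← h]
    exact ih

/-- The coefficient of `x^n` acquires `q^(jn)`, a multiple of `q^N` once `n ≥ 1`. -/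
theorem dvd_rescale_sub_one {K : Type*} [Field K] {N j : ℕ} (hj : N ≤ j)
    (f : PowerSeries (PowerSeries K)) (hf : PowerSeries.coeff 0 f = 1) :
    PowerSeries.C (PowerSeries.X ^ N) ∣ PowerSeries.rescale (PowerSeries.X ^ j) f - 1 := by
  refine ⟨PowerSeries.mk fun n => if n = 0 then 0 else
    PowerSeries.X ^ (j * n - N) * PowerSeries.coeff n f, PowerSeries.ext fun n => ?_⟩
  rw [PowerSeries.coeff_C_mul, PowerSeries.coeff_mk, map_sub, PowerSeries.coeff_rescale,
    PowerSeries.coeff_one]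
  split_ifs with h
  · subst h
    simp [hf]
  · have : N ≤ j * n := hj.trans (Nat.le_mul_of_pos_right j (Nat.pos_of_ne_zero h))
    rw [sub_zero, ← mul_assoc, ← pow_add, Nat.add_sub_cancel' this, pow_mul]

theorem dvd_prod_sub_one {R ι : Type*} [CommRing R] {a : R} (s : Finset ι) (f : ι → R)
    (h : ∀ i ∈ s, a ∣ f i - 1) : a ∣ (∏ i ∈ s, f i) - 1 := by
  classical
  induction s using Finset.induction_on with
  | empty => simp
  | insert i s hi ih =>
    rw [prod_insert hi, show f i * ∏ j ∈ s, f j - 1 =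
      (f i - 1) * ∏ j ∈ s, f j + ((∏ j ∈ s, f j) - 1) by ring]
    exact dvd_add ((h i (mem_insert_self i s)).mul_right _)
      (ih fun j hj => h j (mem_insert_of_mem hj))

/-- Modulo `q^N`, both the factors with `j ≥ N` and the remainder `F(q^N x)` are `1`. -/
theorem dvd_prod_sub_altMajSeries (K : Type*) [Field K] [CharZero K] {N : ℕ} {s : Finset ℕ}
    (hs : range N ⊆ s) :
    PowerSeries.C (PowerSeries.X ^ N) ∣ ∏ j ∈ s, secTanFactor K j - altMajSeries K := by
  have h1 : PowerSeries.C (PowerSeries.X ^ N) ∣ ∏ j ∈ s \ range N, secTanFactor K j - 1 := by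
    refine dvd_prod_sub_one _ _ fun j hj =>
      dvd_rescale_sub_one (by simpa using (mem_sdiff.1 hj).2) _ ?_
    rw [PowerSeries.coeff_map, coeff_secSeries_add_tanSeries, eulerNumber_zero]
    simp
  have h2 := dvd_rescale_sub_one (le_refl N) (altMajSeries K)
    (by simp [coeff_altMajSeries, altMajQuotient_zero])
  rw [altMajSeries_eq_prod_mul K N, ← prod_sdiff hs]
  have := ((dvd_sub h1 h2).mul_left (∏ j ∈ range N, secTanFactor K j))
  convert this using 1
  ring

end AltMaj

theorem mainTheorem8 (K : Type*) [Field K] [CharZero K] [TopologicalSpace K]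
    [DiscreteTopology K] :
    HasProd (fun j : ℕ => substMulPow (secSeries K) j + substMulPow (tanSeries K) j)
      (altMajSeries K) := by
  have hfun : (fun j : ℕ => substMulPow (secSeries K) j + substMulPow (tanSeries K) j) =
      AltMaj.secTanFactor K := by
    funext j
    simp only [AltMaj.secTanFactor, substMulPow, map_add]
  rw [hfun, HasProd, PowerSeries.WithPiTopology.tendsto_iff_coeff_tendsto]
  intro n
  rw [PowerSeries.WithPiTopology.tendsto_iff_coeff_tendsto]
  intro m
  refine tendsto_const_nhds.congr' ?_
  simp only [SummationFilter.unconditional_filter]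
  -- Congruence modulo `q^(m+1)` fixes the coefficient of `q^m`.
  filter_upwards [Filter.eventually_ge_atTop (Finset.range (m + 1))] with s hs
  obtain ⟨g, hg⟩ := AltMaj.dvd_prod_sub_altMajSeries K hs
  rw [sub_eq_iff_eq_add.1 hg, map_add, map_add, PowerSeries.coeff_C_mul,
    PowerSeries.coeff_X_pow_mul', if_neg (by omega), zero_add]
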